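/- Let $N\ge 1$ and $F=\mathbb Z/N\mathbb Z$. For a spin configuration $\sigma\in\{-1,1\}^F$ and an interaction $j\in\mathbb R^F$ put \[H(\sigma,j)=\sum_{f\in F} j_f\sum_{\ell\in F}\sigma_\ell\,\sigma_{\ell+f}.\] The stable degeneracy of $\sigma$ is \[D_{\rm stab}(\sigma)=\big|\{\tau\in\{-1,1\}^F \mid H(\tau,j)=H(\sigma,j)\text{ for all } j\in\mathbb R^F\}\big|,\] and its symmetry-induced degeneracy $D_{\rm sym}(\sigma)$ is the number of distinct configurations of the form $f\mapsto s\,\sigma_{rf+t}$ with $s,r\in\{-1,1\}$ and $t\in F$ (spin flips, reflections and translations). Suppose that $\sigma$ has at most four blocks of equal adjacent spins; that is, $\sigma$ is constant (no blocks), or $\sigma$ is a translate of a cyclic string $(1)^{m_1}(-1)^{m_2}\cdots(1)^{m_{2k-1}}(-1)^{m_{2k}}$ with $k\in\{1,2\}$, integers $m_\ell\ge 1$ and $\sum_{\ell=1}^{2k}m_\ell=N$. Then \[D_{\rm stab}(\sigma)=D_{\rm sym}(\sigma).\] -/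

import Mathlib

/-! Translation invariant Ising models on a finite abelian group `F`. A spin configuration is an
element of the multiplicative group `F → ℤˣ`, that is, of `{-1, 1} ^ F`. -/

/-- The correlation map `A_F(σ)_f = ∑ ℓ, σ_ℓ σ_{ℓ+f}`, with values in `ℤ ^ F`. -/
def isingCorrelation {F : Type*} [AddCommGroup F] [Fintype F] (σ : F → ℤˣ) (f : F) : ℤ :=
  ∑ l : F, (σ l : ℤ) * (σ (l + f) : ℤ)

/-- The energy `H_F(σ, j) = ∑ f, j_f ∑ ℓ, σ_ℓ σ_{ℓ+f}` of the configuration `σ`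
for the interaction `j ∈ ℝ ^ F`. -/
def isingEnergy {F : Type*} [AddCommGroup F] [Fintype F] (σ : F → ℤˣ) (j : F → ℝ) : ℝ :=
  ∑ f : F, j f * (isingCorrelation σ f : ℝ)

/-- The stable degeneracy `D_stab(σ)`: the number of configurations that have the same energy
as `σ` for every interaction `j`. -/
noncomputable def stableDegeneracy {F : Type*} [AddCommGroup F] [Fintype F] (σ : F → ℤˣ) : ℕ :=
  Set.ncard {τ : F → ℤˣ | ∀ j : F → ℝ, isingEnergy τ j = isingEnergy σ j}

/-- The symmetry `Φ_{(s,t,r)}`, `(Φ_{(s,t,r)} σ)_f = s σ_{r f + t}`, composed of a spin flip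
(`s = ±1`), a translation (`t ∈ F`) and a reflection (`r = ±1`). -/
def isingSymmetry {F : Type*} [AddCommGroup F] (s : ℤˣ) (t : F) (r : ℤˣ) (σ : F → ℤˣ) :
    F → ℤˣ :=
  fun f => s * σ ((r : ℤ) • f + t)

/-- The symmetry-induced degeneracy `D_sym(σ)`: the cardinality of the orbit of `σ` under all
the symmetries `Φ_{(s,t,r)}`. -/
noncomputable def symDegeneracy {F : Type*} [AddCommGroup F] (σ : F → ℤˣ) : ℕ :=
  Set.ncard {τ : F → ℤˣ | ∃ (s : ℤˣ) (t : F) (r : ℤˣ), τ = isingSymmetry s t r σ}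

/-- Up to translation, `σ` is the cyclic string `(1)^{m 0} (-1)^{m 1} (1)^{m 2} ⋯` of `n` blocks
of positive lengths `m 0, …, m (n - 1)` with sum `N`: read from the starting point `t`, the block
with (zero-based) index `l` occupies the `m l` positions after the first `∑ i < l, m i` ones, and
its spins are all `(-1)^l`. -/
def IsBlockString {N n : ℕ} (m : Fin n → ℕ) (σ : ZMod N → ℤˣ) : Prop :=
  (∀ l, 0 < m l) ∧ ∑ l, m l = N ∧
    ∃ t : ZMod N, ∀ (l : Fin n) (i : ℕ), i < m l →
      σ (t + ((∑ l' ∈ Finset.Iio l, m l' + i : ℕ) : ZMod N)) = (-1) ^ (l : ℕ)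

/-- `σ` consists of `n` blocks of equal adjacent spins: either `n = 0` and `σ` is one of the two
constant configurations, or `n = 2k` with `k ≥ 1` and `σ` is a translate of a string
`(1)^{m_1} (-1)^{m_2} ⋯ (1)^{m_{2k-1}} (-1)^{m_{2k}}`. -/
def HasBlocks {N : ℕ} (n : ℕ) (σ : ZMod N → ℤˣ) : Prop :=
  (n = 0 ∧ (σ = 1 ∨ σ = -1)) ∨
    ∃ k : ℕ, 1 ≤ k ∧ n = 2 * k ∧ ∃ m : Fin n → ℕ, IsBlockString m σ

/-! ### Symmetries of the Ising model -/

section Symmetry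

variable {F : Type*} [AddCommGroup F]

/-! Energies agree for all `j` exactly when the correlation maps agree, so it suffices that the
correlation map determines `σ` up to symmetry. A second difference of it (`sum_jump_mul_jump`) is
the autocorrelation of the jumps of `σ`, which equal ±2 at the block boundaries, with alternating
signs, and vanish elsewhere. Its value at 0 counts the jumps, so `τ` has as many blocks as `σ`. No
jumps means a constant; for two blocks the two lengths can be read off directly.

For four blocks of lengths `a, b, c, d`, jumps of opposite sign lie at cyclic distances `a, b, c, d`
and jumps of equal sign at `a + b` and `b + c`. Only the signed difference of these two multisets is
visible, and terms may cancel. Moving negative terms across turns equal correlations into an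
equality of two six-element multisets of folded distances (`foldMod_multiset_eq`). After rotating
and reflecting so that `a` is minimal and `b ≤ d`, the smallest entries can be peeled off: first `a
= a'`, then the second smallest gaps agree. The rest splits by whether the two smallest gaps are
adjacent or opposite in each string. The one ambiguity left (`gaps_eq_of_gapPattern_eq`), exchanging
`c` and `d` when `a = b`, is a reflection. -/

/-- Two configurations are related if a symmetry maps the first to the second. -/
def SymmetryRelated (σ τ : F → ℤˣ) : Prop :=
  ∃ (s : ℤˣ) (t : F) (r : ℤˣ), τ = isingSymmetry s t r σ

lemma SymmetryRelated.trans {σ τ ρ : F → ℤˣ} (h : SymmetryRelated σ τ)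
    (h' : SymmetryRelated τ ρ) : SymmetryRelated σ ρ := by
  obtain ⟨s, t, r, rfl⟩ := h
  obtain ⟨s', t', r', rfl⟩ := h'
  refine ⟨s' * s, (r : ℤ) • t' + t, r * r', ?_⟩
  funext f
  simp only [isingSymmetry, smul_add, smul_smul, Units.val_mul, mul_assoc, add_assoc]

lemma SymmetryRelated.symm {σ τ : F → ℤˣ} (h : SymmetryRelated σ τ) : SymmetryRelated τ σ := by
  obtain ⟨s, t, r, rfl⟩ := h
  refine ⟨s, -((r : ℤ) • t), r, ?_⟩
  funext f
  rcases Int.units_eq_one_or s with rfl | rfl <;> rcases Int.units_eq_one_or r with rfl | rfl <;>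
    simp [isingSymmetry]

lemma symmetryRelated_neg (σ : F → ℤˣ) : SymmetryRelated σ (fun f => σ (-f)) :=
  ⟨1, 0, -1, by funext f; simp [isingSymmetry]⟩

lemma SymmetryRelated.correlation_eq [Fintype F] {σ τ : F → ℤˣ} (h : SymmetryRelated σ τ) :
    isingCorrelation τ = isingCorrelation σ := by
  obtain ⟨s, t, r, rfl⟩ := h
  funext f
  have hs : ∀ x y : ℤ, (s : ℤ) * x * (s * y) = x * y := fun x y => by
    rcases Int.units_eq_one_or s with rfl | rfl <;> simp
  simp only [isingCorrelation, isingSymmetry, Units.val_mul, hs]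
  rcases Int.units_eq_one_or r with rfl | rfl
  · simp only [Units.val_one, one_smul]
    exact Fintype.sum_equiv (Equiv.addRight t) _ _ fun l => by
      simp [add_right_comm]
  -- This reindexing exchanges the two spins in each product, hence the `mul_comm` below.
  · refine Fintype.sum_equiv ((Equiv.neg F).trans (Equiv.addRight (t - f))) _ _ fun l => ?_
    simp only [Units.val_neg, Units.val_one, neg_smul, one_smul, Equiv.trans_apply,
      Equiv.neg_apply, Equiv.coe_addRight]
    rw [mul_comm, show -(l + f) + t = -l + (t - f) by abel,
      show -l + (t - f) + f = -l + t by abel]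

/-- The energy is linear in `j` with the correlations as coefficients; the unit vectors extract
them. -/
lemma forall_isingEnergy_eq_iff [Fintype F] (σ τ : F → ℤˣ) :
    (∀ j : F → ℝ, isingEnergy τ j = isingEnergy σ j) ↔
      isingCorrelation τ = isingCorrelation σ := by
  classical
  constructor
  · intro h
    funext f
    simpa [isingEnergy, Pi.single_apply] using h (Pi.single f 1)
  · intro h j
    simp only [isingEnergy, h]

/-- The autocorrelation of the jumps `σ_l - σ_{l-g}` of a configuration is a second difference of
its correlation map. -/
lemma sum_jump_mul_jump [Fintype F] (σ : F → ℤˣ) (g f : F) :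
    ∑ l, ((σ l : ℤ) - σ (l - g)) * ((σ (l + f) : ℤ) - σ (l + f - g)) =
      2 * isingCorrelation σ f - isingCorrelation σ (f + g) - isingCorrelation σ (f - g) := by
  have h1 : ∑ l, (σ (l - g) : ℤ) * σ (l + f - g) = isingCorrelation σ f :=
    Fintype.sum_equiv (Equiv.subRight g) _ _ fun l => by
      simp [show l + f - g = l - g + f by abel]
  have h2 : ∑ l, (σ (l - g) : ℤ) * σ (l + f) = isingCorrelation σ (f + g) :=
    Fintype.sum_equiv (Equiv.subRight g) _ _ fun l => by
      simp [show l - g + (f + g) = l + f by abel]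
  have h3 : ∑ l, (σ l : ℤ) * σ (l + f - g) = isingCorrelation σ (f - g) := by
    simp [isingCorrelation, add_sub_assoc]
  rw [← h2, ← h3, two_mul]
  nth_rw 1 [← h1]
  rw [isingCorrelation, ← Finset.sum_add_distrib, ← Finset.sum_sub_distrib,
    ← Finset.sum_sub_distrib]
  exact Finset.sum_congr rfl fun l _ => by ring

end Symmetry

/-! ### Recovering four cyclic gaps from their signed differences -/

/-- The distance to `0` of the residue class modulo `N` of `x ≤ N`. -/
def foldMod (N x : ℕ) : ℕ := min x (N - x)

/-- The number of ordered pairs of jumps at distance `F` and with the same sign minus that of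
pairs with opposite signs, for a cyclic string of four blocks of lengths `a, b, c, d`. -/
def gapPattern (a b c d F : ℕ) : ℤ :=
  (if a + b = F then 1 else 0) + (if c + d = F then 1 else 0) +
  (if b + c = F then 1 else 0) + (if d + a = F then 1 else 0) -
  ((if a = F then 1 else 0) + (if b = F then 1 else 0) +
   (if c = F then 1 else 0) + (if d = F then 1 else 0) +
   (if b + c + d = F then 1 else 0) + (if c + d + a = F then 1 else 0) +
   (if d + a + b = F then 1 else 0) + (if a + b + c = F then 1 else 0))

/-- Complementary distances fold to the same value. Both indicators fire at once only at the
antipode `2 * F = N`, whence the factor 2. -/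
lemma indicator_add_indicator_compl {N x y F : ℕ} (hx : x + y = N) (hF : 2 * F ≤ N) :
    ((if x = F then 1 else 0) + (if y = F then 1 else 0) : ℤ) =
      (if 2 * F = N then 2 else 1) * (if F = foldMod N x then 1 else 0) := by
  have h : F = foldMod N x ↔ (x = F ∨ y = F) := by unfold foldMod; omega
  simp only [h]
  split_ifs <;> omega

lemma gapPattern_eq {N a b c d F : ℕ} (hN : a + b + c + d = N) (hF : 2 * F ≤ N) :
    gapPattern a b c d F = (if 2 * F = N then 2 else 1) *
      ((if F = foldMod N (a + b) then 1 else 0) + (if F = foldMod N (b + c) then 1 else 0) -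
       ((if F = foldMod N a then 1 else 0) + (if F = foldMod N b then 1 else 0) +
        (if F = foldMod N c then 1 else 0) + (if F = foldMod N d then 1 else 0))) := by
  have h1 := indicator_add_indicator_compl (x := a + b) (y := c + d) (N := N) (by omega) hF
  have h2 := indicator_add_indicator_compl (x := b + c) (y := d + a) (N := N) (by omega) hF
  have h3 := indicator_add_indicator_compl (x := a) (y := b + c + d) (N := N) (by omega) hF
  have h4 := indicator_add_indicator_compl (x := b) (y := c + d + a) (N := N) (by omega) hF
  have h5 := indicator_add_indicator_compl (x := c) (y := d + a + b) (N := N) (by omega) hF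
  have h6 := indicator_add_indicator_compl (x := d) (y := a + b + c) (N := N) (by omega) hF
  unfold gapPattern
  linear_combination h1 + h2 - h3 - h4 - h5 - h6

lemma foldMod_multiset_eq {N a b c d a' b' c' d' : ℕ}
    (ha : 0 < a) (hb : 0 < b) (hc : 0 < c) (hd : 0 < d) (hN : a + b + c + d = N)
    (ha' : 0 < a') (hb' : 0 < b') (hc' : 0 < c') (hd' : 0 < d') (hN' : a' + b' + c' + d' = N)
    (h : ∀ F, 0 < F → F < N → gapPattern a b c d F = gapPattern a' b' c' d' F) :
    (foldMod N a ::ₘ foldMod N b ::ₘ foldMod N c ::ₘ foldMod N d ::ₘ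
      foldMod N (a' + b') ::ₘ foldMod N (b' + c') ::ₘ 0) =
    (foldMod N a' ::ₘ foldMod N b' ::ₘ foldMod N c' ::ₘ foldMod N d' ::ₘ
      foldMod N (a + b) ::ₘ foldMod N (b + c) ::ₘ 0) := by
  ext F
  simp only [Multiset.count_cons, Multiset.count_zero]
  by_cases hF : 0 < F ∧ 2 * F ≤ N
  · have := h F hF.1 (by omega)
    rw [gapPattern_eq hN hF.2, gapPattern_eq hN' hF.2] at this
    have := mul_left_cancel₀ (by split_ifs <;> norm_num) this
    apply Int.natCast_inj.1
    push_cast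
    linarith
  -- Folded distances lie between 1 and `N / 2`, so other values of `F` have multiplicity zero on
  -- both sides.
  · have key : ∀ x, 0 < x → x < N → (if F = foldMod N x then 1 else 0) = 0 := fun x _ _ =>
      if_neg (by unfold foldMod; omega)
    simp only [key a ha (by omega), key b hb (by omega), key c hc (by omega),
      key d hd (by omega), key a' ha' (by omega), key b' hb' (by omega), key c' hc' (by omega),
      key d' hd' (by omega), key (a + b) (by omega) (by omega), key (b + c) (by omega) (by omega),
      key (a' + b') (by omega) (by omega), key (b' + c') (by omega) (by omega)]

lemma Multiset.triple_eq {α : Type*} {x y z x' y' z' : α}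
    (h : (x ::ₘ y ::ₘ z ::ₘ 0) = (x' ::ₘ y' ::ₘ z' ::ₘ 0)) :
    (x = x' ∧ y = y' ∧ z = z') ∨ (x = x' ∧ y = z' ∧ z = y') ∨ (x = y' ∧ y = x' ∧ z = z') ∨
    (x = y' ∧ y = z' ∧ z = x') ∨ (x = z' ∧ y = x' ∧ z = y') ∨ (x = z' ∧ y = y' ∧ z = x') := by
  classical
  have hx : x ∈ (x' ::ₘ y' ::ₘ z' ::ₘ 0) := h ▸ Multiset.mem_cons_self _ _
  have pair : ∀ {p q p' q' : α}, (p ::ₘ q ::ₘ 0) = (p' ::ₘ q' ::ₘ 0) →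
      (p = p' ∧ q = q') ∨ (p = q' ∧ q = p') := fun {p q p' q'} e => by
    have hp : p ∈ (p' ::ₘ q' ::ₘ 0) := e ▸ Multiset.mem_cons_self _ _
    simp only [Multiset.mem_cons, Multiset.notMem_zero, or_false] at hp
    rcases hp with rfl | rfl
    · simp_all
    · rw [Multiset.cons_swap p'] at e
      simp_all
  simp only [Multiset.mem_cons, Multiset.notMem_zero, or_false] at hx
  rcases hx with rfl | rfl | rfl
  · have := pair ((Multiset.cons_inj_right _).1 h)
    tauto
  · rw [Multiset.cons_swap x'] at h
    have := pair ((Multiset.cons_inj_right _).1 h)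
    tauto
  · rw [Multiset.cons_swap y', Multiset.cons_swap x'] at h
    have := pair ((Multiset.cons_inj_right _).1 h)
    tauto

lemma Multiset.mem_of_cons_eq {α : Type*} {s t : Multiset α} {x : α} (h : x ::ₘ s = t) : x ∈ t :=
  h ▸ Multiset.mem_cons_self x s

lemma eq_or_add_eq_of_foldMod_eq {N x y : ℕ} (h : foldMod N x = foldMod N y) (hx : x < N)
    (hy : y < N) : x = y ∨ x + y = N := by
  unfold foldMod at h
  omega

set_option maxHeartbeats 1000000 in
-- Each matching of the triples, with each choice of `x = y` or `x + y = N`, is a linear system. The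
-- exchange of `c` and `d` survives through `(b + c) + (b + d) = N`, which forces `a = b`.
lemma gaps_eq_of_adjacent {N a b c d c' d' : ℕ} (ha : 0 < a) (hab : a ≤ b) (hbc : b ≤ c)
    (hbd : b ≤ d) (hN : a + b + c + d = N) (hbc' : b ≤ c') (hbd' : b ≤ d')
    (hN' : a + b + c' + d' = N)
    (M : (foldMod N c ::ₘ foldMod N d ::ₘ foldMod N (b + c') ::ₘ 0) =
      (foldMod N c' ::ₘ foldMod N d' ::ₘ foldMod N (b + c) ::ₘ 0)) :
    c' = c ∧ d' = d ∨ a = b ∧ c' = d ∧ d' = c := by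
  by_cases hc : c' = c
  · omega
  rcases Multiset.triple_eq M with h | h | h | h | h | h <;>
    obtain ⟨h1, h2, h3⟩ := h <;>
    rcases eq_or_add_eq_of_foldMod_eq h1 (by omega) (by omega) with h1 | h1 <;>
    first
    | (exfalso; omega)
    | rcases eq_or_add_eq_of_foldMod_eq h2 (by omega) (by omega) with h2 | h2 <;>
      first
      | (exfalso; omega)
      | rcases eq_or_add_eq_of_foldMod_eq h3 (by omega) (by omega) with h3 | h3 <;> omega

set_option maxHeartbeats 1000000 in
-- The mixed case is only apparent: locating `foldMod N b'` on the left forces `b' = b`, so the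
-- second string also has its two smallest gaps adjacent.
lemma gaps_eq_of_adjacent_of_opposite {N a b c d b' d' : ℕ} (ha : 0 < a) (hab : a ≤ b)
    (hbc : b ≤ c) (hbd : b ≤ d) (hN : a + b + c + d = N) (hbb' : b ≤ b') (hbd' : b' ≤ d')
    (hN' : a + b' + b + d' = N)
    (M : (foldMod N c ::ₘ foldMod N d ::ₘ foldMod N (a + b') ::ₘ foldMod N (b' + b) ::ₘ 0) =
      (foldMod N b' ::ₘ foldMod N d' ::ₘ foldMod N (a + b) ::ₘ foldMod N (b + c) ::ₘ 0)) :
    b' = b ∧ (b = c ∧ d' = d ∨ a = b ∧ b = d ∧ d' = c) := by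
  have h := Multiset.mem_of_cons_eq M.symm
  simp only [Multiset.mem_cons, Multiset.notMem_zero, or_false] at h
  rcases h with h | h | h | h
  · rw [h, Multiset.cons_inj_right] at M
    rcases eq_or_add_eq_of_foldMod_eq h (by omega) (by omega) with h | h <;>
      rcases Multiset.triple_eq M with h' | h' | h' | h' | h' | h' <;>
      obtain ⟨h1, h2, h3⟩ := h' <;>
      rcases eq_or_add_eq_of_foldMod_eq h1 (by omega) (by omega) with h1 | h1 <;>
      first
      | omega
      | rcases eq_or_add_eq_of_foldMod_eq h2 (by omega) (by omega) with h2 | h2 <;>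
        first
        | omega
        | rcases eq_or_add_eq_of_foldMod_eq h3 (by omega) (by omega) with h3 | h3 <;> omega
  · rw [Multiset.cons_swap, h, Multiset.cons_inj_right] at M
    rcases eq_or_add_eq_of_foldMod_eq h (by omega) (by omega) with h | h <;>
      rcases Multiset.triple_eq M with h' | h' | h' | h' | h' | h' <;>
      obtain ⟨h1, h2, h3⟩ := h' <;>
      rcases eq_or_add_eq_of_foldMod_eq h1 (by omega) (by omega) with h1 | h1 <;>
      first
      | omega
      | rcases eq_or_add_eq_of_foldMod_eq h2 (by omega) (by omega) with h2 | h2 <;>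
        first
        | omega
        | rcases eq_or_add_eq_of_foldMod_eq h3 (by omega) (by omega) with h3 | h3 <;> omega
  -- Here and in the next case `b'` would exceed `d'`.
  · have := eq_or_add_eq_of_foldMod_eq h (by omega) (by omega)
    omega
  · have := eq_or_add_eq_of_foldMod_eq h (by omega) (by omega)
    omega

/-- Peeling works twice more: the sums `a + b'` and `b' + c'` never fold to `c'` or `b'`, and
symmetrically for the other string, so `c` and then `b` is matched from both sides. -/
lemma gaps_eq_of_opposite {N a b c d b' c' d' : ℕ} (ha : 0 < a) (hac : a ≤ c)
    (hcb : c ≤ b) (hbd : b ≤ d) (hN : a + b + c + d = N) (hac' : a ≤ c') (hcb' : c' ≤ b')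
    (hbd' : b' ≤ d') (hN' : a + b' + c' + d' = N)
    (M : (foldMod N c ::ₘ foldMod N b ::ₘ foldMod N d ::ₘ foldMod N (a + b') ::ₘ
        foldMod N (b' + c') ::ₘ 0) =
      (foldMod N c' ::ₘ foldMod N b' ::ₘ foldMod N d' ::ₘ foldMod N (a + b) ::ₘ
        foldMod N (b + c) ::ₘ 0)) :
    c = c' ∧ b = b' := by
  obtain rfl : c = c' := by
    have h1 := Multiset.mem_of_cons_eq M
    have h2 := Multiset.mem_of_cons_eq M.symm
    simp only [Multiset.mem_cons, Multiset.notMem_zero, or_false] at h1 h2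
    apply le_antisymm
    · rcases h2 with h | h | h | h | h <;>
        have := eq_or_add_eq_of_foldMod_eq h (by omega) (by omega) <;> omega
    · rcases h1 with h | h | h | h | h <;>
        have := eq_or_add_eq_of_foldMod_eq h (by omega) (by omega) <;> omega
  rw [Multiset.cons_inj_right] at M
  obtain rfl : b = b' := by
    have h1 := Multiset.mem_of_cons_eq M
    have h2 := Multiset.mem_of_cons_eq M.symm
    simp only [Multiset.mem_cons, Multiset.notMem_zero, or_false] at h1 h2
    apply le_antisymm
    · rcases h2 with h | h | h | h <;>
        have := eq_or_add_eq_of_foldMod_eq h (by omega) (by omega) <;> omega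
    · rcases h1 with h | h | h | h <;>
        have := eq_or_add_eq_of_foldMod_eq h (by omega) (by omega) <;> omega
  exact ⟨rfl, rfl⟩

lemma gaps_eq_of_gapPattern_eq {N a b c d a' b' c' d' : ℕ}
    (ha : 0 < a) (hN : a + b + c + d = N) (ha' : 0 < a') (hN' : a' + b' + c' + d' = N)
    (hab : a ≤ b) (hac : a ≤ c) (hbd : b ≤ d) (hab' : a' ≤ b') (hac' : a' ≤ c') (hbd' : b' ≤ d')
    (h : ∀ F, 0 < F → F < N → gapPattern a b c d F = gapPattern a' b' c' d' F) :
    a' = a ∧ b' = b ∧ (c' = c ∧ d' = d ∨ a = b ∧ c' = d ∧ d' = c) := by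
  have M := foldMod_multiset_eq ha (by omega) (by omega) (by omega) hN ha' (by omega) (by omega)
    (by omega) hN' h
  -- Neither `a + b` nor `b + c` folds to `a`, so `a` is a folded gap of the other string, hence at
  -- least `a'`; the converse is symmetric.
  obtain rfl : a = a' := by
    have h1 := Multiset.mem_of_cons_eq M
    have h2 := Multiset.mem_of_cons_eq M.symm
    simp only [Multiset.mem_cons, Multiset.notMem_zero, or_false, foldMod] at h1 h2
    omega
  rw [Multiset.cons_inj_right] at M
  rcases le_total b c with hbc | hbc <;> rcases le_total b' c' with hbc' | hbc'
  · obtain rfl : b = b' := by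
      have h1 := Multiset.mem_of_cons_eq M
      have h2 := Multiset.mem_of_cons_eq M.symm
      simp only [Multiset.mem_cons, Multiset.notMem_zero, or_false, foldMod] at h1 h2
      omega
    rw [Multiset.cons_inj_right, Multiset.cons_swap (foldMod N d) (foldMod N (a + b)),
      Multiset.cons_swap (foldMod N c) (foldMod N (a + b)),
      Multiset.cons_swap (foldMod N d') (foldMod N (a + b)),
      Multiset.cons_swap (foldMod N c') (foldMod N (a + b)), Multiset.cons_inj_right] at M
    have := gaps_eq_of_adjacent ha hab hbc hbd hN hbc' hbd' hN' M
    omega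
  · rw [Multiset.cons_swap (foldMod N b') (foldMod N c')] at M
    obtain rfl : b = c' := by
      have h1 := Multiset.mem_of_cons_eq M
      have h2 := Multiset.mem_of_cons_eq M.symm
      simp only [Multiset.mem_cons, Multiset.notMem_zero, or_false, foldMod] at h1 h2
      omega
    rw [Multiset.cons_inj_right] at M
    have := gaps_eq_of_adjacent_of_opposite ha hab hbc hbd hN hbc' hbd' hN' M
    omega
  · rw [Multiset.cons_swap (foldMod N b) (foldMod N c)] at M
    obtain rfl : c = b' := by
      have h1 := Multiset.mem_of_cons_eq M
      have h2 := Multiset.mem_of_cons_eq M.symm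
      simp only [Multiset.mem_cons, Multiset.notMem_zero, or_false, foldMod] at h1 h2
      omega
    rw [Multiset.cons_inj_right] at M
    have := gaps_eq_of_adjacent_of_opposite ha hab' hbc' hbd' hN' hbc hbd hN M.symm
    omega
  · rw [Multiset.cons_swap (foldMod N b) (foldMod N c),
      Multiset.cons_swap (foldMod N b') (foldMod N c')] at M
    obtain ⟨rfl, rfl⟩ := gaps_eq_of_opposite ha hac hbc hbd hN hac' hbc' hbd' hN' M
    omega

/-! ### Configurations with four or two blocks -/

section Blocks

variable {N : ℕ}

/-- Read from `t`, the configuration consists of four blocks of lengths `a, b, c, d`, the first one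
with spin `s`. -/
structure FourBlocks (s : ℤˣ) (t : ZMod N) (a b c d : ℕ) (σ : ZMod N → ℤˣ) : Prop where
  ha : 0 < a
  hb : 0 < b
  hc : 0 < c
  hd : 0 < d
  sum_eq : a + b + c + d = N
  apply_add : ∀ i < N, σ (t + i) =
    if i < a then s else if i < a + b then -s else if i < a + b + c then s else -s

/-- Read from `t`, the configuration consists of two blocks of lengths `a, b`, the first one
with spin `s`. -/
structure TwoBlocks (s : ℤˣ) (t : ZMod N) (a b : ℕ) (σ : ZMod N → ℤˣ) : Prop where
  ha : 0 < a
  hb : 0 < b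
  sum_eq : a + b = N
  apply_add : ∀ i < N, σ (t + i) = if i < a then s else -s

lemma ZMod.exists_lt_eq_add [NeZero N] (t l : ZMod N) : ∃ i < N, l = t + (i : ℕ) :=
  ⟨(l - t).val, ZMod.val_lt _, by simp⟩

lemma ZMod.natCast_eq_natCast_iff_of_lt {x y : ℕ} (hx : x < 2 * N) (hy : y < N) :
    (x : ZMod N) = y ↔ x = y ∨ x = y + N := by
  rw [ZMod.natCast_eq_natCast_iff', Nat.mod_eq_of_lt hy]
  rcases lt_or_ge x N with h | h
  · rw [Nat.mod_eq_of_lt h]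
    omega
  · rw [Nat.mod_eq_sub_mod h, Nat.mod_eq_of_lt (by omega)]
    omega

lemma ZMod.add_natCast_eq_iff (t : ZMod N) {x y : ℕ} (hx : x < N) (hy : y < N) :
    t + (x : ZMod N) = t + y ↔ x = y := by
  rw [add_right_inj, ZMod.natCast_eq_natCast_iff_of_lt (by omega) hy]
  omega

lemma ZMod.add_natCast_add_eq_iff (t : ZMod N) {x y F : ℕ} (hx : x < N) (hF : F < N)
    (hy : y < N) : t + (x : ZMod N) + F = t + y ↔ x + F = y ∨ x + F = y + N := by
  rw [add_assoc, add_right_inj, ← Nat.cast_add,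
    ZMod.natCast_eq_natCast_iff_of_lt (by omega) hy]

lemma ZMod.add_natCast_sub_one (t : ZMod N) {i : ℕ} (hi : i < N) :
    t + (i : ZMod N) - 1 = t + ((if i = 0 then N - 1 else i - 1 : ℕ) : ZMod N) := by
  split_ifs with h
  · subst h
    rw [Nat.cast_sub (by omega)]
    simp [sub_eq_add_neg]
  · rw [Nat.cast_sub (by omega)]
    simp [add_sub_assoc]

lemma FourBlocks.rotate {s : ℤˣ} {t : ZMod N} {a b c d : ℕ} {σ : ZMod N → ℤˣ}
    (h : FourBlocks s t a b c d σ) : FourBlocks (-s) (t + (a : ZMod N)) b c d a σ := by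
  obtain ⟨ha, hb, hc, hd, hN, h⟩ := h
  refine ⟨hb, hc, hd, ha, by omega, fun i hi => ?_⟩
  by_cases hi' : a + i < N
  · have := h (a + i) hi'
    rw [Nat.cast_add, ← add_assoc] at this
    rw [this]
    split_ifs <;> first | omega | simp
  · have := h (a + i - N) (by omega)
    rw [Nat.cast_sub (by omega), Nat.cast_add, ZMod.natCast_self, sub_zero, ← add_assoc] at this
    rw [this]
    split_ifs <;> first | omega | simp

lemma FourBlocks.reflect {s : ℤˣ} {t : ZMod N} {a b c d : ℕ} {σ : ZMod N → ℤˣ}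
    (h : FourBlocks s t a b c d σ) : FourBlocks (-s) (1 - t) d c b a (fun f => σ (-f)) := by
  obtain ⟨ha, hb, hc, hd, hN, h⟩ := h
  refine ⟨hd, hc, hb, ha, by omega, fun i hi => ?_⟩
  have := h (N - 1 - i) (by omega)
  rw [Nat.cast_sub (by omega), Nat.cast_sub (by omega)] at this
  have e : -(1 - t + (i : ZMod N)) = t + ((N : ZMod N) - (1 : ℕ) - i) := by
    simp only [ZMod.natCast_self, Nat.cast_one]
    ring
  rw [e, this]
  split_ifs <;> first | omega | simp

lemma TwoBlocks.rotate {s : ℤˣ} {t : ZMod N} {a b : ℕ} {σ : ZMod N → ℤˣ}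
    (h : TwoBlocks s t a b σ) : TwoBlocks (-s) (t + (a : ZMod N)) b a σ := by
  obtain ⟨ha, hb, hN, h⟩ := h
  refine ⟨hb, ha, by omega, fun i hi => ?_⟩
  by_cases hi' : a + i < N
  · have := h (a + i) hi'
    rw [Nat.cast_add, ← add_assoc] at this
    rw [this]
    split_ifs <;> first | omega | simp
  · have := h (a + i - N) (by omega)
    rw [Nat.cast_sub (by omega), Nat.cast_add, ZMod.natCast_self, sub_zero, ← add_assoc] at this
    rw [this]
    split_ifs <;> first | omega | simp

lemma FourBlocks.symmetryRelated [NeZero N] {s s' : ℤˣ} {t t' : ZMod N} {a b c d : ℕ}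
    {σ τ : ZMod N → ℤˣ} (h : FourBlocks s t a b c d σ) (h' : FourBlocks s' t' a b c d τ) :
    SymmetryRelated σ τ := by
  refine ⟨s' * s, t - t', 1, ?_⟩
  funext f
  obtain ⟨i, hi, rfl⟩ := ZMod.exists_lt_eq_add t' f
  rw [isingSymmetry, h'.apply_add i hi, Units.val_one, one_smul,
    show t' + (i : ZMod N) + (t - t') = t + i by ring, h.apply_add i hi]
  have := Int.units_mul_self s
  split_ifs <;> simp [mul_assoc, this]

lemma TwoBlocks.symmetryRelated [NeZero N] {s s' : ℤˣ} {t t' : ZMod N} {a b : ℕ}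
    {σ τ : ZMod N → ℤˣ} (h : TwoBlocks s t a b σ) (h' : TwoBlocks s' t' a b τ) :
    SymmetryRelated σ τ := by
  refine ⟨s' * s, t - t', 1, ?_⟩
  funext f
  obtain ⟨i, hi, rfl⟩ := ZMod.exists_lt_eq_add t' f
  rw [isingSymmetry, h'.apply_add i hi, Units.val_one, one_smul,
    show t' + (i : ZMod N) + (t - t') = t + i by ring, h.apply_add i hi]
  have := Int.units_mul_self s
  split_ifs <;> simp [mul_assoc, this]

/-- Up to a reflection, the first of the four blocks has minimal length, and the second one is not
longer than the fourth. -/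
lemma FourBlocks.exists_sorted {s : ℤˣ} {t : ZMod N} {a b c d : ℕ} {σ : ZMod N → ℤˣ}
    (h : FourBlocks s t a b c d σ) : ∃ ρ, SymmetryRelated σ ρ ∧
      ∃ s t a b c d, FourBlocks s t a b c d ρ ∧ a ≤ b ∧ a ≤ c ∧ b ≤ d := by
  have key : ∀ {s t a b c d}, FourBlocks s t a b c d σ → a ≤ b → a ≤ c → a ≤ d →
      ∃ ρ, SymmetryRelated σ ρ ∧
        ∃ s t a b c d, FourBlocks s t a b c d ρ ∧ a ≤ b ∧ a ≤ c ∧ b ≤ d := by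
    intro s t a b c d h hb hc hd
    rcases le_total b d with hbd | hbd
    · exact ⟨σ, ⟨1, 0, 1, by funext; simp [isingSymmetry]⟩, _, _, _, _, _, _, h, hb, hc, hbd⟩
    -- Reflection gives `d, c, b, a`; three rotations turn this into `a, d, c, b`.
    · exact ⟨_, symmetryRelated_neg σ, _, _, _, _, _, _, h.reflect.rotate.rotate.rotate,
        hd, hc, hbd⟩
  have : (a ≤ b ∧ a ≤ c ∧ a ≤ d) ∨ (b ≤ c ∧ b ≤ d ∧ b ≤ a) ∨ (c ≤ d ∧ c ≤ a ∧ c ≤ b) ∨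
      (d ≤ a ∧ d ≤ b ∧ d ≤ c) := by omega
  rcases this with ⟨h1, h2, h3⟩ | ⟨h1, h2, h3⟩ | ⟨h1, h2, h3⟩ | ⟨h1, h2, h3⟩
  · exact key h h1 h2 h3
  · exact key h.rotate h1 h2 h3
  · exact key h.rotate.rotate h1 h2 h3
  · exact key h.rotate.rotate.rotate h1 h2 h3

/-! ### Jump autocorrelation of block strings -/

/-- The autocorrelation of the jumps of a configuration on `ℤ/N`. -/
def jumpCorrelation [NeZero N] (σ : ZMod N → ℤˣ) (f : ZMod N) : ℤ :=
  ∑ l, ((σ l : ℤ) - σ (l - 1)) * ((σ (l + f) : ℤ) - σ (l + f - 1))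

lemma jumpCorrelation_congr [NeZero N] {σ τ : ZMod N → ℤˣ}
    (h : isingCorrelation τ = isingCorrelation σ) : jumpCorrelation τ = jumpCorrelation σ := by
  funext f
  rw [jumpCorrelation, jumpCorrelation, sum_jump_mul_jump, sum_jump_mul_jump, h]

lemma FourBlocks.jump [NeZero N] {s : ℤˣ} {t : ZMod N} {a b c d : ℕ} {σ : ZMod N → ℤˣ}
    (h : FourBlocks s t a b c d σ) (l : ZMod N) : (σ l : ℤ) - σ (l - 1) =
      2 * s * ((if l = t + (0 : ℕ) then 1 else 0) - (if l = t + a then 1 else 0) +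
        (if l = t + (a + b : ℕ) then 1 else 0) - (if l = t + (a + b + c : ℕ) then 1 else 0)) := by
  obtain ⟨ha, hb, hc, hd, hN, h⟩ := h
  obtain ⟨i, hi, rfl⟩ := ZMod.exists_lt_eq_add t l
  rw [ZMod.add_natCast_sub_one t hi, h i hi, h _ (by split_ifs <;> omega)]
  simp only [ZMod.add_natCast_eq_iff t hi (show 0 < N by omega),
    ZMod.add_natCast_eq_iff t hi (show a < N by omega),
    ZMod.add_natCast_eq_iff t hi (show a + b < N by omega),
    ZMod.add_natCast_eq_iff t hi (show a + b + c < N by omega)]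
  rcases Int.units_eq_one_or s with rfl | rfl <;> split_ifs <;> first | omega | simp

lemma TwoBlocks.jump [NeZero N] {s : ℤˣ} {t : ZMod N} {a b : ℕ} {σ : ZMod N → ℤˣ}
    (h : TwoBlocks s t a b σ) (l : ZMod N) : (σ l : ℤ) - σ (l - 1) =
      2 * s * ((if l = t + (0 : ℕ) then 1 else 0) - (if l = t + a then 1 else 0)) := by
  obtain ⟨ha, hb, hN, h⟩ := h
  obtain ⟨i, hi, rfl⟩ := ZMod.exists_lt_eq_add t l
  rw [ZMod.add_natCast_sub_one t hi, h i hi, h _ (by split_ifs <;> omega)]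
  simp only [ZMod.add_natCast_eq_iff t hi (show 0 < N by omega),
    ZMod.add_natCast_eq_iff t hi (show a < N by omega)]
  rcases Int.units_eq_one_or s with rfl | rfl <;> split_ifs <;> first | omega | simp

end Blocks

section Blocks

variable {N : ℕ}

lemma sum_indicator_mul {F : Type*} [Fintype F] [DecidableEq F] (x : F) (g : F → ℤ) :
    ∑ l, (if l = x then 1 else 0) * g l = g x := by
  simp

lemma jumpCorrelation_eq_of_jump [NeZero N] {σ : ZMod N → ℤˣ} {s : ℤˣ} {D : ZMod N → ℤ}
    (h : ∀ l, (σ l : ℤ) - σ (l - 1) = 2 * s * D l) (f : ZMod N) :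
    jumpCorrelation σ f = 4 * ∑ l, D l * D (l + f) := by
  rw [jumpCorrelation, Finset.mul_sum]
  refine Finset.sum_congr rfl fun l _ => ?_
  rw [h, h]
  rcases Int.units_eq_one_or s with rfl | rfl <;> simp <;> ring

/-- Of the sixteen ordered pairs of jumps, the four diagonal ones contribute at `F = 0` and the
other twelve make up `gapPattern`. -/
lemma FourBlocks.jumpCorrelation_eq [NeZero N] {s : ℤˣ} {t : ZMod N} {a b c d : ℕ}
    {σ : ZMod N → ℤˣ} (h : FourBlocks s t a b c d σ) {F : ℕ} (hF : F < N) :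
    jumpCorrelation σ F = 4 * ((if F = 0 then 4 else 0) + gapPattern a b c d F) := by
  rw [jumpCorrelation_eq_of_jump h.jump]
  congr 1
  obtain ⟨ha, hb, hc, hd, hN, -⟩ := h
  simp only [add_mul, sub_mul, Finset.sum_add_distrib, Finset.sum_sub_distrib, sum_indicator_mul]
  have h0 : 0 < N := by omega
  have h1 : a < N := by omega
  have h2 : a + b < N := by omega
  have h3 : a + b + c < N := by omega
  simp only [ZMod.add_natCast_add_eq_iff t h0 hF h0, ZMod.add_natCast_add_eq_iff t h0 hF h1,
    ZMod.add_natCast_add_eq_iff t h0 hF h2, ZMod.add_natCast_add_eq_iff t h0 hF h3,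
    ZMod.add_natCast_add_eq_iff t h1 hF h0, ZMod.add_natCast_add_eq_iff t h1 hF h1,
    ZMod.add_natCast_add_eq_iff t h1 hF h2, ZMod.add_natCast_add_eq_iff t h1 hF h3,
    ZMod.add_natCast_add_eq_iff t h2 hF h0, ZMod.add_natCast_add_eq_iff t h2 hF h1,
    ZMod.add_natCast_add_eq_iff t h2 hF h2, ZMod.add_natCast_add_eq_iff t h2 hF h3,
    ZMod.add_natCast_add_eq_iff t h3 hF h0, ZMod.add_natCast_add_eq_iff t h3 hF h1,
    ZMod.add_natCast_add_eq_iff t h3 hF h2, ZMod.add_natCast_add_eq_iff t h3 hF h3]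
  simp only [show (0 + F = 0 ∨ 0 + F = 0 + N) ↔ F = 0 by omega,
    show (0 + F = a ∨ 0 + F = a + N) ↔ a = F by omega,
    show (0 + F = a + b ∨ 0 + F = a + b + N) ↔ a + b = F by omega,
    show (0 + F = a + b + c ∨ 0 + F = a + b + c + N) ↔ a + b + c = F by omega,
    show (a + F = 0 ∨ a + F = 0 + N) ↔ b + c + d = F by omega,
    show (a + F = a ∨ a + F = a + N) ↔ F = 0 by omega,
    show (a + F = a + b ∨ a + F = a + b + N) ↔ b = F by omega,
    show (a + F = a + b + c ∨ a + F = a + b + c + N) ↔ b + c = F by omega,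
    show (a + b + F = 0 ∨ a + b + F = 0 + N) ↔ c + d = F by omega,
    show (a + b + F = a ∨ a + b + F = a + N) ↔ c + d + a = F by omega,
    show (a + b + F = a + b ∨ a + b + F = a + b + N) ↔ F = 0 by omega,
    show (a + b + F = a + b + c ∨ a + b + F = a + b + c + N) ↔ c = F by omega,
    show (a + b + c + F = 0 ∨ a + b + c + F = 0 + N) ↔ d = F by omega,
    show (a + b + c + F = a ∨ a + b + c + F = a + N) ↔ d + a = F by omega,
    show (a + b + c + F = a + b ∨ a + b + c + F = a + b + N) ↔ d + a + b = F by omega,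
    show (a + b + c + F = a + b + c ∨ a + b + c + F = a + b + c + N) ↔ F = 0 by omega]
  unfold gapPattern
  rw [show (if F = 0 then 4 else 0 : ℤ) = 4 * (if F = 0 then 1 else 0) by split_ifs <;> rfl]
  ring

lemma TwoBlocks.jumpCorrelation_eq [NeZero N] {s : ℤˣ} {t : ZMod N} {a b : ℕ}
    {σ : ZMod N → ℤˣ} (h : TwoBlocks s t a b σ) {F : ℕ} (hF : F < N) :
    jumpCorrelation σ F = 4 * (2 * (if F = 0 then 1 else 0) -
      (if F = a then 1 else 0) - (if F = b then 1 else 0)) := by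
  rw [jumpCorrelation_eq_of_jump h.jump]
  congr 1
  obtain ⟨ha, hb, hN, -⟩ := h
  simp only [sub_mul, Finset.sum_sub_distrib, sum_indicator_mul]
  have h0 : 0 < N := by omega
  have h1 : a < N := by omega
  simp only [ZMod.add_natCast_add_eq_iff t h0 hF h0, ZMod.add_natCast_add_eq_iff t h0 hF h1,
    ZMod.add_natCast_add_eq_iff t h1 hF h0, ZMod.add_natCast_add_eq_iff t h1 hF h1]
  simp only [show (0 + F = 0 ∨ 0 + F = 0 + N) ↔ F = 0 by omega,
    show (0 + F = a ∨ 0 + F = a + N) ↔ F = a by omega,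
    show (a + F = 0 ∨ a + F = 0 + N) ↔ F = b by omega,
    show (a + F = a ∨ a + F = a + N) ↔ F = 0 by omega]
  ring

/-! ### Recovering the blocks from the jumps -/

/-- The positions at which the spin differs from the preceding one. -/
def jumpSet [NeZero N] (σ : ZMod N → ℤˣ) : Finset (ZMod N) := {l | σ l ≠ σ (l - 1)}

lemma jumpCorrelation_zero [NeZero N] (σ : ZMod N → ℤˣ) :
    jumpCorrelation σ 0 = 4 * (jumpSet σ).card := by
  rw [jumpCorrelation, jumpSet, Finset.card_filter, Nat.cast_sum, Finset.mul_sum]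
  refine Finset.sum_congr rfl fun l _ => ?_
  rw [add_zero]
  rcases Int.units_eq_one_or (σ l) with h | h <;>
    rcases Int.units_eq_one_or (σ (l - 1)) with h' | h' <;> simp [h, h']

/-- The distances from `t` to the other jumps. -/
def jumpOffsets (σ : ZMod N → ℤˣ) (t : ZMod N) : Finset ℕ :=
  {i ∈ Finset.Ioo 0 N | σ (t + (i : ℕ)) ≠ σ (t + (i - 1 : ℕ))}

lemma card_jumpOffsets [NeZero N] {σ : ZMod N → ℤˣ} {t : ZMod N} (ht : t ∈ jumpSet σ) :
    (jumpOffsets σ t).card + 1 = (jumpSet σ).card := by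
  have hN := NeZero.pos N
  rw [← Finset.card_erase_add_one ht]
  congr 1
  refine Finset.card_bij (fun i _ => t + (i : ZMod N)) ?_ ?_ ?_
  · intro i hi
    simp only [jumpOffsets, Finset.mem_filter, Finset.mem_Ioo] at hi
    obtain ⟨⟨h0, h1⟩, h2⟩ := hi
    simp only [Finset.mem_erase, jumpSet, Finset.mem_filter, Finset.mem_univ, true_and]
    constructor
    · intro h
      have := (ZMod.add_natCast_eq_iff t h1 hN).1 (by simpa using h)
      omega
    · rwa [ZMod.add_natCast_sub_one t h1, if_neg (by omega)]
  · intro i hi j hj h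
    simp only [jumpOffsets, Finset.mem_filter, Finset.mem_Ioo] at hi hj
    exact (ZMod.add_natCast_eq_iff t hi.1.2 hj.1.2).1 h
  · intro l hl
    obtain ⟨i, hi, rfl⟩ := ZMod.exists_lt_eq_add t l
    simp only [Finset.mem_erase, jumpSet, Finset.mem_filter, Finset.mem_univ, true_and] at hl
    have h0 : i ≠ 0 := by
      rintro rfl
      simp at hl
    refine ⟨i, ?_, rfl⟩
    rw [ZMod.add_natCast_sub_one t hi, if_neg h0] at hl
    simp only [jumpOffsets, Finset.mem_filter, Finset.mem_Ioo]
    exact ⟨⟨by omega, hi⟩, hl.2⟩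

lemma apply_add_succ (σ : ZMod N → ℤˣ) (t : ZMod N) {i : ℕ} (hi : i + 1 < N) :
    σ (t + (i + 1 : ℕ)) = if i + 1 ∈ jumpOffsets σ t then -σ (t + i) else σ (t + i) := by
  have : i + 1 ∈ jumpOffsets σ t ↔ σ (t + (i + 1 : ℕ)) ≠ σ (t + i) := by
    simp [jumpOffsets, hi]
  simp only [this]
  generalize σ (t + (i + 1 : ℕ)) = x
  generalize σ (t + (i : ℕ)) = y
  rcases Int.units_eq_one_or x with rfl | rfl <;>
    rcases Int.units_eq_one_or y with rfl | rfl <;> simp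

lemma Finset.card_eq_three_sorted {S : Finset ℕ} (h : S.card = 3) :
    ∃ p q r, p < q ∧ q < r ∧ S = {p, q, r} := by
  obtain ⟨x, y, z, hxy, hxz, hyz, rfl⟩ := Finset.card_eq_three.1 h
  rcases lt_or_gt_of_ne hxy with h1 | h1 <;> rcases lt_or_gt_of_ne hxz with h2 | h2 <;>
    rcases lt_or_gt_of_ne hyz with h3 | h3
  · exact ⟨x, y, z, h1, h3, rfl⟩
  · exact ⟨x, z, y, h2, h3, by ext; simp; tauto⟩
  · omega
  · exact ⟨z, x, y, h2, h1, by ext; simp; tauto⟩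
  · exact ⟨y, x, z, h1, h2, by ext; simp; tauto⟩
  · omega
  · exact ⟨y, z, x, h3, h2, by ext; simp; tauto⟩
  · exact ⟨z, y, x, h3, h1, by ext; simp; tauto⟩

lemma exists_fourBlocks [NeZero N] {σ : ZMod N → ℤˣ} (h : (jumpSet σ).card = 4) :
    ∃ s t a b c d, FourBlocks s t a b c d σ := by
  obtain ⟨t, ht⟩ := Finset.card_pos.1 (by omega : 0 < (jumpSet σ).card)
  have hc := card_jumpOffsets ht
  obtain ⟨p, q, r, hpq, hqr, hS⟩ := Finset.card_eq_three_sorted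
    (by omega : (jumpOffsets σ t).card = 3)
  have hmem : ∀ i ∈ jumpOffsets σ t, 0 < i ∧ i < N := fun i hi => by
    simp only [jumpOffsets, Finset.mem_filter, Finset.mem_Ioo] at hi
    exact hi.1
  have hp := hmem p (by simp [hS])
  have hr := hmem r (by simp [hS])
  -- Block lengths are the gaps between the consecutive jumps at offsets `0, p, q, r`, closing up at
  -- `N`.
  refine ⟨σ t, t, p, q - p, r - q, N - r, hp.1, by omega, by omega, by omega, by omega, ?_⟩
  intro i
  induction i with
  | zero => intro; simp [hp.1]
  | succ i ih =>
    intro hi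
    rw [apply_add_succ σ t hi, ih (by omega), hS]
    simp only [Finset.mem_insert, Finset.mem_singleton]
    split_ifs <;> first | omega | simp

lemma exists_twoBlocks [NeZero N] {σ : ZMod N → ℤˣ} (h : (jumpSet σ).card = 2) :
    ∃ s t a b, TwoBlocks s t a b σ := by
  obtain ⟨t, ht⟩ := Finset.card_pos.1 (by omega : 0 < (jumpSet σ).card)
  have hc := card_jumpOffsets ht
  obtain ⟨p, hS⟩ := Finset.card_eq_one.1 (by omega : (jumpOffsets σ t).card = 1)
  have hp : 0 < p ∧ p < N := by
    have : p ∈ jumpOffsets σ t := by simp [hS]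
    simp only [jumpOffsets, Finset.mem_filter, Finset.mem_Ioo] at this
    exact this.1
  refine ⟨σ t, t, p, N - p, hp.1, by omega, by omega, ?_⟩
  intro i
  induction i with
  | zero => intro; simp [hp.1]
  | succ i ih =>
    intro hi
    rw [apply_add_succ σ t hi, ih (by omega), hS]
    simp only [Finset.mem_singleton]
    split_ifs <;> first | omega | simp

lemma eq_const_of_jumpSet_card_eq_zero [NeZero N] {σ : ZMod N → ℤˣ} (h : (jumpSet σ).card = 0)
    (l : ZMod N) : σ l = σ 0 := by
  have hstep : ∀ l, σ l = σ (l - 1) := fun l => by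
    by_contra hl
    have : l ∈ jumpSet σ := by simpa [jumpSet] using hl
    simp [Finset.card_eq_zero.1 h] at this
  have key : ∀ i : ℕ, σ (i : ZMod N) = σ 0 := fun i => by
    induction i with
    | zero => simp
    | succ i ih => rw [hstep, ← ih]; simp
  simpa using key l.val

lemma jumpSet_card_congr [NeZero N] {σ τ : ZMod N → ℤˣ}
    (h : jumpCorrelation τ = jumpCorrelation σ) : (jumpSet τ).card = (jumpSet σ).card := by
  have := congrFun h 0
  rw [jumpCorrelation_zero, jumpCorrelation_zero] at this
  omega

lemma FourBlocks.jumpSet_card [NeZero N] {s : ℤˣ} {t : ZMod N} {a b c d : ℕ}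
    {σ : ZMod N → ℤˣ} (h : FourBlocks s t a b c d σ) : (jumpSet σ).card = 4 := by
  have e := h.jumpCorrelation_eq (F := 0) (NeZero.pos N)
  have := h.ha
  have := h.hb
  have := h.hc
  have := h.hd
  rw [Nat.cast_zero, jumpCorrelation_zero] at e
  have hz : gapPattern a b c d 0 = 0 := by
    unfold gapPattern
    repeat rw [if_neg (by omega)]
    norm_num
  rw [hz] at e
  simp only [if_true] at e
  omega

lemma TwoBlocks.jumpSet_card [NeZero N] {s : ℤˣ} {t : ZMod N} {a b : ℕ}
    {σ : ZMod N → ℤˣ} (h : TwoBlocks s t a b σ) : (jumpSet σ).card = 2 := by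
  have e := h.jumpCorrelation_eq (F := 0) (NeZero.pos N)
  have := h.ha
  have := h.hb
  rw [Nat.cast_zero, jumpCorrelation_zero, if_pos rfl, if_neg (by omega), if_neg (by omega)] at e
  omega

/-! ### Equal correlations force a symmetry -/

lemma FourBlocks.symmetryRelated_of_correlation_eq [NeZero N] {s : ℤˣ} {t : ZMod N}
    {a b c d : ℕ} {σ τ : ZMod N → ℤˣ} (h : FourBlocks s t a b c d σ)
    (hC : isingCorrelation τ = isingCorrelation σ) : SymmetryRelated σ τ := by
  obtain ⟨_, _, _, _, _, _, h'⟩ :=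
    exists_fourBlocks ((jumpSet_card_congr (jumpCorrelation_congr hC)).trans h.jumpSet_card)
  obtain ⟨ρ, hρ, s, t, a, b, c, d, hb, h1, h2, h3⟩ := h.exists_sorted
  obtain ⟨ρ', hρ', s', t', a', b', c', d', hb', h1', h2', h3'⟩ := h'.exists_sorted
  have hJ : jumpCorrelation ρ = jumpCorrelation ρ' :=
    jumpCorrelation_congr (by rw [hρ.correlation_eq, hρ'.correlation_eq, hC])
  have hG : ∀ F, 0 < F → F < N → gapPattern a b c d F = gapPattern a' b' c' d' F := by
    intro F _ hF
    have := congrFun hJ F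
    rw [hb.jumpCorrelation_eq hF, hb'.jumpCorrelation_eq hF] at this
    linarith
  refine hρ.trans (SymmetryRelated.trans ?_ hρ'.symm)
  obtain ⟨rfl, rfl, ⟨rfl, rfl⟩ | ⟨rfl, rfl, rfl⟩⟩ :=
    gaps_eq_of_gapPattern_eq hb.ha hb.sum_eq hb'.ha hb'.sum_eq h1 h2 h3 h1' h2' h3' hG
  · exact hb.symmetryRelated hb'
  -- Reflecting and rotating twice gives `b, a, d, c`, which is the other string since `a = b`.
  · exact (symmetryRelated_neg ρ).trans (hb.reflect.rotate.rotate.symmetryRelated hb')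

lemma TwoBlocks.symmetryRelated_of_correlation_eq [NeZero N] {s : ℤˣ} {t : ZMod N}
    {a b : ℕ} {σ τ : ZMod N → ℤˣ} (h : TwoBlocks s t a b σ)
    (hC : isingCorrelation τ = isingCorrelation σ) : SymmetryRelated σ τ := by
  have hJ := jumpCorrelation_congr hC
  obtain ⟨_, _, a', b', h'⟩ := exists_twoBlocks ((jumpSet_card_congr hJ).trans h.jumpSet_card)
  have hab := h.sum_eq
  have hab' := h'.sum_eq
  have ha := h.ha
  have hb := h.hb
  -- At distance `a` the jump correlation of `σ` is negative, while that of `τ` would vanish if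
  -- neither of its lengths were `a`.
  have : a = a' ∨ a = b' := by
    by_contra! hne
    have := congrFun hJ (a : ℕ)
    rw [h.jumpCorrelation_eq (by omega), h'.jumpCorrelation_eq (by omega), if_neg (by omega),
      if_neg hne.1, if_neg hne.2, if_pos rfl] at this
    split_ifs at this <;> omega
  rcases this with rfl | rfl
  · obtain rfl : b = b' := by omega
    exact h.symmetryRelated h'
  · obtain rfl : b = a' := by omega
    exact h.symmetryRelated h'.rotate

lemma symmetryRelated_of_forall_eq [NeZero N] {σ τ : ZMod N → ℤˣ} (hσ : ∀ l, σ l = σ 0)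
    (hC : isingCorrelation τ = isingCorrelation σ) : SymmetryRelated σ τ := by
  have h0 : (jumpSet σ).card = 0 := by
    rw [Finset.card_eq_zero, jumpSet, Finset.filter_eq_empty_iff]
    intro l _
    rw [hσ l, hσ (l - 1)]
    simp
  have hτ := eq_const_of_jumpSet_card_eq_zero
    ((jumpSet_card_congr (jumpCorrelation_congr hC)).trans h0)
  refine ⟨τ 0 * σ 0, 0, 1, ?_⟩
  funext l
  rw [isingSymmetry, hσ (_ + _), hτ, mul_assoc, Int.units_mul_self, mul_one]

lemma IsBlockString.twoBlocks {m : Fin 2 → ℕ} {σ : ZMod N → ℤˣ} (h : IsBlockString m σ) :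
    ∃ t, TwoBlocks 1 t (m 0) (m 1) σ := by
  obtain ⟨hm, hN, t, ht⟩ := h
  rw [Fin.sum_univ_two] at hN
  refine ⟨t, hm 0, hm 1, hN, fun i hi => ?_⟩
  split_ifs with h
  · simpa [show Finset.Iio (0 : Fin 2) = ∅ from rfl] using ht 0 i h
  · have := ht 1 (i - m 0) (by omega)
    rw [show Finset.Iio (1 : Fin 2) = {0} from rfl, Finset.sum_singleton,
      show m 0 + (i - m 0) = i by omega] at this
    simpa using this

lemma IsBlockString.fourBlocks {m : Fin 4 → ℕ} {σ : ZMod N → ℤˣ} (h : IsBlockString m σ) :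
    ∃ t, FourBlocks 1 t (m 0) (m 1) (m 2) (m 3) σ := by
  obtain ⟨hm, hN, t, ht⟩ := h
  rw [Fin.sum_univ_four] at hN
  refine ⟨t, hm 0, hm 1, hm 2, hm 3, hN, fun i hi => ?_⟩
  split_ifs with h h' h''
  · simpa [show Finset.Iio (0 : Fin 4) = ∅ from rfl] using ht 0 i h
  · have := ht 1 (i - m 0) (by omega)
    rw [show ∑ l ∈ Finset.Iio (1 : Fin 4), m l = m 0 from rfl,
      show m 0 + (i - m 0) = i by omega] at this
    simpa using this
  · have := ht 2 (i - (m 0 + m 1)) (by omega)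
    rw [show Finset.Iio (2 : Fin 4) = {0, 1} from rfl, Finset.sum_pair (by decide),
      show m 0 + m 1 + (i - (m 0 + m 1)) = i by omega] at this
    simpa using this
  · have := ht 3 (i - (m 0 + m 1 + m 2)) (by omega)
    rw [show Finset.Iio (3 : Fin 4) = {0, 1, 2} from rfl, Finset.sum_insert (by decide),
      Finset.sum_pair (by decide),
      show m 0 + (m 1 + m 2) + (i - (m 0 + m 1 + m 2)) = i by omega] at this
    simpa [pow_succ] using this

end Blocks

theorem proposition6p1 (N : ℕ) [NeZero N] (n : ℕ) (hn : n ≤ 4) (σ : ZMod N → ℤˣ)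
    (hσ : HasBlocks n σ) :
    stableDegeneracy σ = symDegeneracy σ := by
  unfold stableDegeneracy symDegeneracy
  congr 1
  ext τ
  simp only [Set.mem_ofPred_eq, forall_isingEnergy_eq_iff]
  refine ⟨fun hC => ?_, fun h => SymmetryRelated.correlation_eq h⟩
  rcases hσ with ⟨-, rfl | rfl⟩ | ⟨k, hk, rfl, m, hm⟩
  · exact symmetryRelated_of_forall_eq (fun _ => rfl) hC
  · exact symmetryRelated_of_forall_eq (fun _ => rfl) hC
  · obtain rfl | rfl : k = 1 ∨ k = 2 := by omega
    · obtain ⟨t, h⟩ := IsBlockString.twoBlocks (m := m) hm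
      exact h.symmetryRelated_of_correlation_eq hC
    · obtain ⟨t, h⟩ := IsBlockString.fourBlocks (m := m) hm
      exact h.symmetryRelated_of_correlation_eq hC
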